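/- Let $\ell\ge 2$ be an integer and $\mathcal S=\{0,\dots,\ell-1\}$. Let $P=(p_{ij})_{i,j\in\mathcal S}$ be an irreducible stochastic matrix with $p_{ij}\neq 1$ for all $i,j$, and let $X=(X_n)_{n\ge 1}$ be a Markov chain on $\mathcal S$ with transition matrix $P$ and an arbitrary initial distribution. For a word $\varepsilon_1\cdots\varepsilon_n$ over $\mathcal S$ ($n\ge 0$) put $$I_{\varepsilon_1\cdots\varepsilon_n}=\Big[\sum_{i=1}^n\frac{\varepsilon_i}{\ell^i},\ \sum_{i=1}^n\frac{\varepsilon_i}{\ell^i}+\frac1{\ell^n}\Big).$$ Then there is exactly one Borel probability measure $m$ on $\mathbb R$ with $$m(I_{\varepsilon_1\cdots\varepsilon_n})=\mathbb P(X_1=\varepsilon_1,\dots,X_n=\varepsilon_n)\quad\text{for all } n\ge 0 \text{ and all words } \varepsilon_1\cdots\varepsilon_n,$$ and exactly one probability vector $\pi=(\pi_0,\dots,\pi_{\ell-1})$ with $\pi P=\pi$. Moreover the lower dimension $\dim_* m=\inf\{\dim_H E: E \text{ Borel},\ m(E)>0\}$ and the upper dimension $\dim^* m=\inf\{\dim_H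 E: E\text{ Borel},\ m(E)=1\}$ coincide, where $\dim_H$ is the Hausdorff dimension, and their common value $\dim m$ is $$\dim m=\langle \pi\,|\,H\rangle=\sum_{k=0}^{\ell-1}\pi_k\,h_\ell(L_k),$$ where $L_k=(p_{k0},\dots,p_{k,\ell-1})$ is the $k$-th row of $P$, $H=(h_\ell(L_0),\dots,h_\ell(L_{\ell-1}))$, and $h_\ell(p)=-\sum_{i=0}^{\ell-1}p_i\log_\ell p_i$ with $0\log_\ell 0=0$. -/

import Mathlib

open MeasureTheory
open scoped ENNReal Matrix

namespace MarkovDriven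

/-- `X = (X 0, X 1, …)` is a (time-homogeneous) Markov chain on `{0, …, ℓ-1}` with transition
matrix `P`, on the space `(Ω, ℙ)`: for every possible past `ε 0, …, ε n` and every state `j`,
`ℙ(X (n+1) = j | X 0 = ε 0, …, X n = ε n) = P (ε n) j`, written without division, so that pasts of
probability zero impose nothing. The initial distribution (the law of `X 0`) is arbitrary.
Time starts at `0` here. -/
structure IsMarkovChain {Ω : Type*} [MeasurableSpace Ω] (ℙ : Measure Ω) {ℓ : ℕ}
    (P : Matrix (Fin ℓ) (Fin ℓ) ℝ) (X : ℕ → Ω → Fin ℓ) : Prop where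
  measurable : ∀ n, Measurable (X n)
  transition : ∀ (n : ℕ) (ε : Fin (n + 1) → Fin ℓ) (j : Fin ℓ),
    ℙ {ω | (∀ i : Fin (n + 1), X i ω = ε i) ∧ X (n + 1) ω = j} =
      ℙ {ω | ∀ i : Fin (n + 1), X i ω = ε i} * ENNReal.ofReal (P (ε (Fin.last n)) j)

/-- The `ℓ`-adic interval of order `n` attached to the word `ε 0 ⋯ ε (n-1)`:
`[∑ ε i / ℓ ^ (i+1), ∑ ε i / ℓ ^ (i+1) + 1 / ℓ ^ n)`. -/
def adicInterval {ℓ n : ℕ} (ε : Fin n → Fin ℓ) : Set ℝ :=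
  Set.Ico (∑ i : Fin n, ((ε i : ℕ) : ℝ) / (ℓ : ℝ) ^ ((i : ℕ) + 1))
    (∑ i : Fin n, ((ε i : ℕ) : ℝ) / (ℓ : ℝ) ^ ((i : ℕ) + 1) + 1 / (ℓ : ℝ) ^ n)

/-- `m` is the probability measure driven by the process `X`: the mass of the interval of a word is
the probability that `X` starts with this word. -/
structure IsDrivenBy {Ω : Type*} [MeasurableSpace Ω] (m : Measure ℝ) (ℙ : Measure Ω) {ℓ : ℕ}
    (X : ℕ → Ω → Fin ℓ) : Prop where
  isProbabilityMeasure : IsProbabilityMeasure m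
  measure_adicInterval : ∀ (n : ℕ) (ε : Fin n → Fin ℓ),
    m (adicInterval ε) = ℙ {ω | ∀ i : Fin n, X i ω = ε i}

/-- `π` is a stationary distribution of `P`: a probability vector with `π P = π`. -/
structure IsStationary {ℓ : ℕ} (P : Matrix (Fin ℓ) (Fin ℓ) ℝ) (π : Fin ℓ → ℝ) : Prop where
  nonneg : ∀ i, 0 ≤ π i
  sum_eq_one : ∑ i, π i = 1
  vecMul_eq : π ᵥ* P = π

/-- The entropy `h_ℓ(p) = -∑ p i log_ℓ (p i)`, with `0 log 0 = 0`. -/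
noncomputable def entropy {ℓ : ℕ} (p : Fin ℓ → ℝ) : ℝ :=
  -∑ i, p i * Real.logb ℓ (p i)

/-- Lower dimension: `inf {dim_H E : μ E > 0}`. -/
noncomputable def lowerDim (μ : Measure ℝ) : ℝ≥0∞ :=
  ⨅ (E : Set ℝ) (_ : MeasurableSet E) (_ : 0 < μ E), dimH E

/-- Upper dimension of a probability measure: `inf {dim_H E : μ E = 1}`. -/
noncomputable def upperDim (μ : Measure ℝ) : ℝ≥0∞ :=
  ⨅ (E : Set ℝ) (_ : MeasurableSet E) (_ : μ E = 1), dimH E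

/-- `μ` is unidimensional and its dimension is the real number `d`. -/
def HasDimension (μ : Measure ℝ) (d : ℝ) : Prop :=
  0 ≤ d ∧ lowerDim μ = ENNReal.ofReal d ∧ upperDim μ = ENNReal.ofReal d

end MarkovDriven

/-! ### Hausdorff dimension from the masses of adic cells. -/

namespace MarkovDriven

open Filter Topology
open scoped NNReal

/-! The measure is the law of the real number whose base-`ℓ` digits are the states of the chain. A
path ending in `ℓ - 1` forever would escape the half-open intervals of its prefixes; since no state
is absorbing, such paths are negligible and the cell of order `n` around a typical point has the
probability of the first `n` states as its mass.

By a mass distribution argument, the dimension is the exponential decay rate in base `ℓ` of these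
masses (`le_dimH_of_measure_adicCell_le`, `exists_dimH_le_of_le_measure_adicCell`). Minus the
logarithm of a cylinder probability is a sum over transitions, so a law of large numbers is needed,
for any initial law. Irreducibility solves the Poisson equation (`exists_eq_const_add_sub_mulVec`):
the conditional mean of a term is a constant plus a coboundary. The coboundary telescopes along the
path, the centred remainder is controlled by exponential moments, and pairing with `π` identifies
the constant as the mean entropy. The same equation gives uniqueness of `π`. -/

/-- The half-open `b`-adic interval `[k / b ^ n, (k + 1) / b ^ n)`. -/
def adicCell (b n : ℕ) (k : ℤ) : Set ℝ := {x | ⌊(b : ℝ) ^ n * x⌋ = k}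

lemma measurable_floor_pow_mul (b n : ℕ) : Measurable fun x : ℝ => ⌊(b : ℝ) ^ n * x⌋ :=
  Int.measurable_floor.comp (measurable_id.const_mul _)

lemma measurableSet_adicCell (b n : ℕ) (k : ℤ) : MeasurableSet (adicCell b n k) :=
  measurable_floor_pow_mul b n (measurableSet_singleton k)

lemma measurable_measure_adicCell_floor (m : Measure ℝ) (b n : ℕ) :
    Measurable fun x : ℝ => m (adicCell b n ⌊(b : ℝ) ^ n * x⌋) :=
  (measurable_from_top (f := fun k : ℤ => m (adicCell b n k))).comp (measurable_floor_pow_mul b n)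

lemma pairwise_disjoint_adicCell (b n : ℕ) : Pairwise (Function.onFun Disjoint (adicCell b n)) :=
  fun _ _ hij => Set.disjoint_left.2 fun _ hi hj => hij (hi.symm.trans hj)

lemma ediam_adicCell_le {b : ℕ} (hb : 1 < b) (n : ℕ) (k : ℤ) :
    Metric.ediam (adicCell b n k) ≤ ((b : ℝ≥0∞) ^ n)⁻¹ := by
  have hb0 : (0 : ℝ) < (b : ℝ) ^ n := by positivity
  have hr : ((b : ℝ≥0∞) ^ n)⁻¹ = ENNReal.ofReal ((b : ℝ) ^ n)⁻¹ := by
    rw [ENNReal.ofReal_inv_of_pos hb0, ENNReal.ofReal_pow (by positivity), ENNReal.ofReal_natCast]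
  rw [hr]
  refine Metric.ediam_le fun x hx y hy => ?_
  rw [edist_dist]
  refine ENNReal.ofReal_le_ofReal ?_
  have hx' := Int.floor_eq_iff.1 hx
  have hy' := Int.floor_eq_iff.1 hy
  rw [Real.dist_eq, abs_le, neg_le]
  constructor <;> rw [inv_eq_one_div, le_div_iff₀ hb0] <;> nlinarith

lemma inv_natCast_pow_tendsto_zero {b : ℕ} (hb : 1 < b) :
    Tendsto (fun n : ℕ => ((b : ℝ≥0∞) ^ n)⁻¹) atTop (𝓝 0) := by
  simp_rw [ENNReal.inv_pow]
  exact ENNReal.tendsto_pow_atTop_nhds_zero_of_lt_one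
    (ENNReal.inv_lt_one.2 (by exact_mod_cast hb))

/-- If almost every `b`-adic cell of order `n` has mass at least `b ^ (-n s)` eventually, then the
measure is carried by a set of dimension at most `s`. -/
theorem exists_dimH_le_of_le_measure_adicCell (m : Measure ℝ) [IsFiniteMeasure m] {b : ℕ}
    (hb : 1 < b) (s : ℝ≥0)
    (h : ∀ᵐ x ∂m, ∀ᶠ n in atTop,
      (((b : ℝ≥0∞) ^ n)⁻¹) ^ (s : ℝ) ≤ m (adicCell b n ⌊(b : ℝ) ^ n * x⌋)) :
    ∃ E, MeasurableSet E ∧ m Eᶜ = 0 ∧ dimH E ≤ s := by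
  set B : ℕ → Set ℝ := fun N => {x | ∀ n ≥ N,
    (((b : ℝ≥0∞) ^ n)⁻¹) ^ (s : ℝ) ≤ m (adicCell b n ⌊(b : ℝ) ^ n * x⌋)} with hB
  have hBm : ∀ N, MeasurableSet (B N) := fun N => by
    simp only [hB, Set.ofPred_forall]
    exact MeasurableSet.iInter fun n => MeasurableSet.iInter fun _ =>
      measurableSet_le measurable_const (measurable_measure_adicCell_floor m b n)
  refine ⟨⋃ N, B N, MeasurableSet.iUnion hBm, ?_, ?_⟩
  · refine measure_mono_null ?_ (ae_iff.1 h)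
    intro x hx hx'
    obtain ⟨N, hN⟩ := eventually_atTop.1 hx'
    exact hx (Set.mem_iUnion.2 ⟨N, hN⟩)
  · rw [dimH_iUnion]
    refine iSup_le fun N => dimH_le_of_hausdorffMeasure_ne_top ?_
    -- For `n ≥ N` the heavy cells cover `B N`. They are disjoint and each has `diam ^ s` at most
    -- its mass, so the covering sums never exceed the total mass.
    have key := Measure.hausdorffMeasure_le_liminf_tsum
      (ι := fun n : ℕ => {k : ℤ // (((b : ℝ≥0∞) ^ n)⁻¹) ^ (s : ℝ) ≤ m (adicCell b n k)})
      (s : ℝ) (B N) (fun n : ℕ => ((b : ℝ≥0∞) ^ n)⁻¹) (inv_natCast_pow_tendsto_zero hb)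
      (fun n k => adicCell b n k) (Eventually.of_forall fun n k => ediam_adicCell_le hb n k)
      (eventually_atTop.2 ⟨N, fun n hn x hx => Set.mem_iUnion.2 ⟨⟨_, hx n hn⟩, rfl⟩⟩)
    refine ne_top_of_le_ne_top (measure_ne_top m Set.univ) (key.trans ?_)
    refine liminf_le_of_le (by isBoundedDefault) fun c hc => ?_
    obtain ⟨n, hn⟩ := hc.exists
    refine hn.trans ?_
    calc _ ≤ ∑' k : {k : ℤ // (((b : ℝ≥0∞) ^ n)⁻¹) ^ (s : ℝ) ≤ m (adicCell b n k)},
          m (adicCell b n k) := ENNReal.tsum_le_tsum fun k =>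
            (ENNReal.rpow_le_rpow (ediam_adicCell_le hb n k) s.2).trans k.2
      _ = m (⋃ k : {k : ℤ // (((b : ℝ≥0∞) ^ n)⁻¹) ^ (s : ℝ) ≤ m (adicCell b n k)},
          adicCell b n k) := (measure_iUnion
            ((pairwise_disjoint_adicCell b n).comp_of_injective Subtype.coe_injective)
            fun k => measurableSet_adicCell b n k).symm
      _ ≤ m Set.univ := measure_mono (Set.subset_univ _)

/-- If almost every `b`-adic cell of order `n` has mass at most `b ^ (-n s)` eventually, then every
set of positive measure has dimension at least `s`. -/
theorem le_dimH_of_measure_adicCell_le (m : Measure ℝ) {b : ℕ} (hb : 1 < b) {s : ℝ≥0} (hs : 0 < s)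
    (h : ∀ᵐ x ∂m, ∀ᶠ n in atTop,
      m (adicCell b n ⌊(b : ℝ) ^ n * x⌋) ≤ (((b : ℝ≥0∞) ^ n)⁻¹) ^ (s : ℝ))
    {E : Set ℝ} (hE : m E ≠ 0) : s ≤ dimH E := by
  set A : ℕ → Set ℝ := fun N => {x | ∀ n ≥ N,
    m (adicCell b n ⌊(b : ℝ) ^ n * x⌋) ≤ (((b : ℝ≥0∞) ^ n)⁻¹) ^ (s : ℝ)} with hA
  have hAm : ∀ N, MeasurableSet (A N) := fun N => by
    simp only [hA, Set.ofPred_forall]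
    exact MeasurableSet.iInter fun n => MeasurableSet.iInter fun _ =>
      measurableSet_le (measurable_measure_adicCell_floor m b n) measurable_const
  obtain ⟨N, hN⟩ : ∃ N, m (E ∩ A N) ≠ 0 := by
    by_contra! h0
    refine hE (measure_mono_null (t := {x | ¬ ∀ᶠ n in atTop,
      m (adicCell b n ⌊(b : ℝ) ^ n * x⌋) ≤ (((b : ℝ≥0∞) ^ n)⁻¹) ^ (s : ℝ)} ∪ ⋃ N, E ∩ A N)
      ?_ (measure_union_null (ae_iff.1 h) (measure_iUnion_null h0)))
    intro x hx
    by_cases hx' : ∀ᶠ n in atTop,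
        m (adicCell b n ⌊(b : ℝ) ^ n * x⌋) ≤ (((b : ℝ≥0∞) ^ n)⁻¹) ^ (s : ℝ)
    · obtain ⟨N, hN⟩ := eventually_atTop.1 hx'
      exact Or.inr (Set.mem_iUnion.2 ⟨N, hx, hN⟩)
    · exact Or.inl hx'
  -- After restriction to `A N` the bound holds for every cell: a cell either misses `A N` or
  -- contains a point at which the bound is known.
  have hcell : ∀ n ≥ N, ∀ k, m.restrict (A N) (adicCell b n k) ≤ (((b : ℝ≥0∞) ^ n)⁻¹) ^ (s : ℝ) := by
    intro n hn k
    rw [Measure.restrict_apply (measurableSet_adicCell b n k)]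
    rcases (adicCell b n k ∩ A N).eq_empty_or_nonempty with h0 | ⟨y, hy, hyA⟩
    · simp [h0]
    · have := hyA n hn
      rw [show ⌊(b : ℝ) ^ n * y⌋ = k from hy] at this
      exact (measure_mono Set.inter_subset_left).trans this
  have hball : ∀ n ≥ N, ∀ U : Set ℝ, Metric.ediam U ≤ ((b : ℝ≥0∞) ^ n)⁻¹ →
      m.restrict (A N) U ≤ 3 * (((b : ℝ≥0∞) ^ n)⁻¹) ^ (s : ℝ) := by
    intro n hn U hU
    rcases U.eq_empty_or_nonempty with rfl | ⟨x, hx⟩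
    · simp
    have hb0 : (0 : ℝ) < (b : ℝ) ^ n := by positivity
    have hr : ((b : ℝ≥0∞) ^ n)⁻¹ = ENNReal.ofReal ((b : ℝ) ^ n)⁻¹ := by
      rw [ENNReal.ofReal_inv_of_pos hb0, ENNReal.ofReal_pow (by positivity),
        ENNReal.ofReal_natCast]
    set k := ⌊(b : ℝ) ^ n * x⌋ with hk
    have hsub : U ⊆ adicCell b n (k - 1) ∪ adicCell b n k ∪ adicCell b n (k + 1) := by
      intro y hy
      have hd : dist x y ≤ ((b : ℝ) ^ n)⁻¹ := by
        have := (Metric.edist_le_ediam_of_mem hx hy).trans hU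
        rwa [hr, edist_dist, ENNReal.ofReal_le_ofReal_iff (by positivity)] at this
      rw [Real.dist_eq, abs_le, neg_le, inv_eq_one_div, le_div_iff₀ hb0, le_div_iff₀ hb0] at hd
      have h1 := Int.floor_le ((b : ℝ) ^ n * x)
      have h2 := Int.lt_floor_add_one ((b : ℝ) ^ n * x)
      have h3 := Int.floor_le ((b : ℝ) ^ n * y)
      have h4 := Int.lt_floor_add_one ((b : ℝ) ^ n * y)
      have h5 : k < ⌊(b : ℝ) ^ n * y⌋ + 2 := by
        rify
        linarith
      have h6 : ⌊(b : ℝ) ^ n * y⌋ < k + 2 := by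
        rify
        linarith
      have : ⌊(b : ℝ) ^ n * y⌋ = k - 1 ∨ ⌊(b : ℝ) ^ n * y⌋ = k ∨ ⌊(b : ℝ) ^ n * y⌋ = k + 1 := by
        lia
      rcases this with h | h | h
      · exact Or.inl (Or.inl h)
      · exact Or.inl (Or.inr h)
      · exact Or.inr h
    calc m.restrict (A N) U ≤ _ := measure_mono hsub
      _ ≤ m.restrict (A N) (adicCell b n (k - 1)) + m.restrict (A N) (adicCell b n k)
          + m.restrict (A N) (adicCell b n (k + 1)) :=
        (measure_union_le _ _).trans (add_le_add_left (measure_union_le _ _) _)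
      _ ≤ _ := add_le_add (add_le_add (hcell n hn _) (hcell n hn _)) (hcell n hn _)
      _ = _ := by ring
  -- A set of diameter at most `b ^ (-n)` meets at most three cells; the factor `b ^ s` pays for
  -- rounding its diameter up to a power of `b`.
  set C : ℝ≥0∞ := 3 * (b : ℝ≥0∞) ^ (s : ℝ) with hC
  have hC0 : C ≠ 0 := mul_ne_zero (by simp) (by
    rw [Ne, ENNReal.rpow_eq_zero_iff]; simp; intro; lia)
  have hCt : C ≠ ∞ := ENNReal.mul_ne_top (by simp)
    (ENNReal.rpow_ne_top_of_nonneg s.2 (ENNReal.natCast_ne_top b))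
  have hle : C⁻¹ • m.restrict (A N) ≤ Measure.hausdorffMeasure (s : ℝ) := by
    refine Measure.le_hausdorffMeasure _ _ ((b : ℝ≥0∞) ^ N)⁻¹ (by simp) fun U hU => ?_
    rw [Measure.smul_apply, smul_eq_mul, ENNReal.inv_mul_le_iff hC0 hCt]
    -- Diameter zero is the case without a scale; there `0 < s` forces the mass to vanish.
    by_cases hall : ∀ n ≥ N, Metric.ediam U ≤ ((b : ℝ≥0∞) ^ n)⁻¹
    · have hlim : Tendsto (fun n : ℕ => 3 * (((b : ℝ≥0∞) ^ n)⁻¹) ^ (s : ℝ)) atTop (𝓝 0) := by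
        have := ENNReal.Tendsto.const_mul (a := 3)
          ((inv_natCast_pow_tendsto_zero hb).ennrpow_const (s : ℝ)) (Or.inr (by simp))
        rwa [ENNReal.zero_rpow_of_pos (by exact_mod_cast hs), mul_zero] at this
      exact (ge_of_tendsto hlim (eventually_atTop.2 ⟨N, fun n hn => hball n hn U (hall n hn)⟩)).trans
        zero_le
    · obtain ⟨n, hn, h1, h2⟩ : ∃ n ≥ N, Metric.ediam U ≤ ((b : ℝ≥0∞) ^ n)⁻¹ ∧
          ((b : ℝ≥0∞) ^ (n + 1))⁻¹ < Metric.ediam U := by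
        by_contra! hcon
        exact hall fun n hn => Nat.le_induction hU (fun n hn ih => hcon n hn ih) n hn
      calc _ ≤ _ := hball n hn U h1
        _ = C * (((b : ℝ≥0∞) ^ (n + 1))⁻¹) ^ (s : ℝ) := by
          rw [hC, mul_assoc, ← ENNReal.mul_rpow_of_nonneg _ _ s.coe_nonneg, pow_succ',
            ENNReal.mul_inv (by simp) (by simp), ← mul_assoc,
            ENNReal.mul_inv_cancel (by simp; lia) (by simp), one_mul]
        _ ≤ _ := by gcongr
  refine le_dimH_of_hausdorffMeasure_ne_zero fun h0 => hN ?_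
  have := hle E
  rw [h0, Measure.smul_apply, smul_eq_mul, Measure.restrict_apply' (hAm N)] at this
  exact ((mul_eq_zero.1 (le_antisymm this zero_le)).resolve_left
    (ENNReal.inv_ne_zero.2 hCt))

end MarkovDriven

/-! ### Stationary vectors and the Poisson equation. -/

namespace MarkovDriven

section Stationary

variable {ι : Type*} [Fintype ι] [DecidableEq ι] {P : Matrix ι ι ℝ}

/-- Maximum principle: a function whose value nowhere exceeds its mean under an irreducible
stochastic matrix is constant. -/
lemma eq_of_le_mulVec (hP : P ∈ Matrix.rowStochastic ℝ ι) (hirr : P.IsIrreducible)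
    {g : ι → ℝ} (hg : ∀ i, g i ≤ (P *ᵥ g) i) (i j : ι) : g i = g j := by
  obtain ⟨a, -, ha⟩ := Finset.exists_max_image Finset.univ g ⟨i, Finset.mem_univ i⟩
  have step : ∀ c d, 0 < P c d → g c = g a → g d = g a := by
    intro c d hcd hc
    have h1 : ∑ k, P c k * (g a - g k) ≤ 0 := by
      have h2 := hg c
      simp only [Matrix.mulVec, dotProduct] at h2
      simp only [mul_sub, Finset.sum_sub_distrib, ← Finset.sum_mul,
        Matrix.sum_row_of_mem_rowStochastic hP c, one_mul]
      linarith
    have h3 : P c d * (g a - g d) ≤ 0 := le_trans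
      (Finset.single_le_sum (f := fun k => P c k * (g a - g k)) (fun k _ => mul_nonneg
        (hirr.nonneg c k) (sub_nonneg.2 (ha k (Finset.mem_univ k)))) (Finset.mem_univ d)) h1
    have h4 := ha d (Finset.mem_univ d)
    nlinarith
  have all : ∀ k, g k = g a := by
    intro k
    obtain ⟨p, -⟩ := hirr.connected a k
    let := P.toQuiver
    induction p with
    | nil => rfl
    | cons _ e ih => exact step _ _ e.down ih
  rw [all i, all j]

/-- Poisson equation: every function is a constant plus a coboundary `g - P g`. -/
lemma exists_eq_const_add_sub_mulVec (hP : P ∈ Matrix.rowStochastic ℝ ι) (hirr : P.IsIrreducible)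
    (f : ι → ℝ) : ∃ (c : ℝ) (g : ι → ℝ), ∀ i, f i = c + (g i - (P *ᵥ g) i) := by
  classical
  rcases isEmpty_or_nonempty ι with hι | ⟨⟨o⟩⟩
  · exact ⟨0, f, fun i => (hι.false i).elim⟩
  -- the linear map `g ↦ g o + (g - P g)` is injective, hence bijective
  let T : (ι → ℝ) →ₗ[ℝ] (ι → ℝ) :=
    { toFun := fun g i => g o + (g i - (P *ᵥ g) i)
      map_add' := fun g h => by
        ext i; simp only [Matrix.mulVec_add, Pi.add_apply]; ring
      map_smul' := fun r g => by
        ext i; simp only [Matrix.mulVec_smul, Pi.smul_apply, smul_eq_mul, RingHom.id_apply]; ring }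
  have hT : Function.Injective T := by
    rw [← LinearMap.ker_eq_bot, LinearMap.ker_eq_bot']
    intro g hg
    have h0 : ∀ i, g o + (g i - (P *ᵥ g) i) = 0 := fun i => congrFun hg i
    have hconst : ∀ i j, g i = g j := by
      -- On the kernel, `g - P g` is the constant `-g o`, so the maximum principle applies to `g` or
      -- to `-g` according to its sign.
      rcases le_total 0 (g o) with ho | ho
      · exact eq_of_le_mulVec hP hirr fun i => by linarith [h0 i]
      · intro i j
        have := eq_of_le_mulVec (g := -g) hP hirr (fun i => by
          simp only [Matrix.mulVec_neg, Pi.neg_apply]; linarith [h0 i]) i j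
        simpa using this
    have hPg : (P *ᵥ g) o = g o := by
      simp only [Matrix.mulVec, dotProduct]
      rw [Finset.sum_congr rfl fun j _ => by rw [hconst j o], ← Finset.sum_mul,
        Matrix.sum_row_of_mem_rowStochastic hP, one_mul]
    have : g o = 0 := by linarith [h0 o]
    ext i
    rw [hconst i o, this, Pi.zero_apply]
  obtain ⟨g, hg⟩ := LinearMap.surjective_of_injective hT f
  exact ⟨g o, g, fun i => (congrFun hg i).symm⟩

end Stationary

variable {ℓ : ℕ} {P : Matrix (Fin ℓ) (Fin ℓ) ℝ}

/-- A stationary vector annihilates coboundaries, so the constant of the Poisson equation is the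
stationary mean. -/
lemma IsStationary.dotProduct_eq {π f g : Fin ℓ → ℝ} {c : ℝ} (hπ : IsStationary P π)
    (hf : ∀ i, f i = c + (g i - (P *ᵥ g) i)) : π ⬝ᵥ f = c := by
  have h1 : π ⬝ᵥ (P *ᵥ g) = π ⬝ᵥ g := by rw [Matrix.dotProduct_mulVec, hπ.vecMul_eq]
  have h2 : f = (fun _ => c) + (g - P *ᵥ g) := funext hf
  rw [h2, dotProduct_add, dotProduct_sub, h1, sub_self, add_zero]
  simp [dotProduct, ← Finset.sum_mul, hπ.sum_eq_one]

/-- The constant vector is a right fixed vector, hence a left fixed vector `v` exists. Then `|v| ≤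
|v| P` entrywise, and both sides have the same total because rows sum to one, so equality holds and
`|v|` only needs normalizing. -/
lemma exists_isStationary [NeZero ℓ] (hP : P ∈ Matrix.rowStochastic ℝ (Fin ℓ)) :
    ∃ π, IsStationary P π := by
  have hdet : (1 - P).det = 0 := by
    refine Matrix.exists_mulVec_eq_zero_iff.1 ⟨1, one_ne_zero, ?_⟩
    rw [Matrix.sub_mulVec, Matrix.one_mulVec, hP.2, sub_self]
  obtain ⟨v, hv0, hv⟩ := Matrix.exists_vecMul_eq_zero_iff.2 hdet
  have hv' : v ᵥ* P = v := by
    rw [Matrix.vecMul_sub, Matrix.vecMul_one, sub_eq_zero] at hv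
    exact hv.symm
  have hle : ∀ j, |v j| ≤ ∑ i, |v i| * P i j := fun j => by
    have : v j = ∑ i, v i * P i j := (congrFun hv' j).symm
    calc |v j| = |∑ i, v i * P i j| := by rw [← this]
      _ ≤ ∑ i, |v i * P i j| := Finset.abs_sum_le_sum_abs _ _
      _ = _ := Finset.sum_congr rfl fun i _ => by rw [abs_mul, abs_of_nonneg (hP.1 i j)]
  have hsum : ∑ j, |v j| = ∑ j, ∑ i, |v i| * P i j := by
    rw [Finset.sum_comm]
    simp_rw [← Finset.mul_sum, Matrix.sum_row_of_mem_rowStochastic hP, mul_one]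
  have heq : ∀ j, |v j| = ∑ i, |v i| * P i j := fun j =>
    (Finset.sum_eq_sum_iff_of_le fun j _ => hle j).1 hsum j (Finset.mem_univ j)
  have hS : 0 < ∑ i, |v i| := by
    obtain ⟨i, hi⟩ := Function.ne_iff.1 hv0
    exact Finset.sum_pos' (fun i _ => abs_nonneg _) ⟨i, Finset.mem_univ i, abs_pos.2 hi⟩
  refine ⟨fun i => |v i| / ∑ i, |v i|, fun i => by positivity, ?_, ?_⟩
  · rw [← Finset.sum_div, div_self hS.ne']
  · ext j
    simp only [Matrix.vecMul, dotProduct]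
    rw [heq j, Finset.sum_div]
    exact Finset.sum_congr rfl fun i _ => by ring

theorem existsUnique_isStationary [NeZero ℓ] (hP : P ∈ Matrix.rowStochastic ℝ (Fin ℓ))
    (hirr : P.IsIrreducible) : ∃! π, IsStationary P π := by
  obtain ⟨π, hπ⟩ := exists_isStationary hP
  refine ⟨π, hπ, fun ρ hρ => ?_⟩
  ext i
  -- Solving the equation for an indicator makes the coordinate `i` of every stationary vector equal
  -- to the same `c`.
  obtain ⟨c, g, hg⟩ := exists_eq_const_add_sub_mulVec hP hirr (Pi.single i 1)
  rw [← dotProduct_single_one ρ i, ← dotProduct_single_one π i, hπ.dotProduct_eq hg,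
    hρ.dotProduct_eq hg]

lemma entropy_nonneg {p : Fin ℓ → ℝ} (h0 : ∀ i, 0 ≤ p i) (h1 : ∀ i, p i ≤ 1) :
    0 ≤ entropy p := by
  rw [entropy, ← Finset.sum_neg_distrib]
  refine Finset.sum_nonneg fun i _ => ?_
  rw [Real.logb, neg_nonneg]
  exact mul_nonpos_of_nonneg_of_nonpos (h0 i) (div_nonpos_of_nonpos_of_nonneg
    (Real.log_nonpos (h0 i) (h1 i)) (Real.log_natCast_nonneg ℓ))

end MarkovDriven

/-! ### Limit theorems for the chain. -/

namespace MarkovDriven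

open Filter Topology

section Chain

variable {Ω : Type*} [MeasurableSpace Ω] {ℙ : Measure Ω} {ℓ : ℕ} {P : Matrix (Fin ℓ) (Fin ℓ) ℝ}
  {X : ℕ → Ω → Fin ℓ}

/-- Markov property: averaging over the next step, given the past. -/
lemma IsMarkovChain.lintegral_mul (hX : IsMarkovChain ℙ P X) (n : ℕ)
    (Φ : (Fin (n + 1) → Fin ℓ) → ℝ≥0∞) (W : Fin ℓ → Fin ℓ → ℝ≥0∞) :
    ∫⁻ ω, Φ (fun i => X i ω) * W (X n ω) (X (n + 1) ω) ∂ℙ =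
      ∫⁻ ω, Φ (fun i => X i ω) * ∑ j, ENNReal.ofReal (P (X n ω) j) * W (X n ω) j ∂ℙ := by
  have hZ : Measurable fun ω => (fun i : Fin (n + 1) => X i ω) :=
    measurable_pi_lambda _ fun i => hX.measurable i
  have hZY : Measurable fun ω => ((fun i : Fin (n + 1) => X i ω), X (n + 1) ω) :=
    hZ.prodMk (hX.measurable (n + 1))
  have h1 := lintegral_map (μ := ℙ) (f := fun p : (Fin (n + 1) → Fin ℓ) × Fin ℓ =>
    Φ p.1 * W (p.1 (Fin.last n)) p.2) (measurable_of_countable _) hZY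
  have h2 := lintegral_map (μ := ℙ) (f := fun z : Fin (n + 1) → Fin ℓ =>
    Φ z * ∑ j, ENNReal.ofReal (P (z (Fin.last n)) j) * W (z (Fin.last n)) j)
    (measurable_of_countable _) hZ
  simp only [Fin.val_last] at h1 h2
  rw [← h1, ← h2, lintegral_fintype, lintegral_fintype, Fintype.sum_prod_type]
  refine Finset.sum_congr rfl fun z _ => ?_
  rw [Finset.mul_sum, Finset.sum_mul]
  refine Finset.sum_congr rfl fun j _ => ?_
  have e1 : (fun ω => ((fun i : Fin (n + 1) => X i ω), X (n + 1) ω)) ⁻¹' {(z, j)} =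
      {ω | (∀ i : Fin (n + 1), X i ω = z i) ∧ X (n + 1) ω = j} := by
    ext ω; simp [funext_iff]
  have e2 : (fun ω => (fun i : Fin (n + 1) => X i ω)) ⁻¹' {z} =
      {ω | ∀ i : Fin (n + 1), X i ω = z i} := by
    ext ω; simp [funext_iff]
  rw [Measure.map_apply hZY (measurableSet_singleton _),
    Measure.map_apply hZ (measurableSet_singleton _), e1, e2, hX.transition]
  ring

/-- Conditioning on the past integrates out the last factor at cost `c`. Indicator weights bound the
probability of being stuck; exponential weights give Chernoff bounds. -/
lemma IsMarkovChain.lintegral_prod_le [IsProbabilityMeasure ℙ] (hX : IsMarkovChain ℙ P X)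
    {W : Fin ℓ → Fin ℓ → ℝ≥0∞} {c : ℝ≥0∞}
    (hW : ∀ i, ∑ j, ENNReal.ofReal (P i j) * W i j ≤ c) (N n : ℕ) :
    ∫⁻ ω, ∏ k ∈ Finset.range n, W (X (N + k) ω) (X (N + k + 1) ω) ∂ℙ ≤ c ^ n := by
  induction n with
  | zero => simp
  | succ n ih =>
    have h := hX.lintegral_mul (N + n) (fun z => ∏ k : Fin n,
      W (z ⟨N + k, by lia⟩) (z ⟨N + k + 1, by lia⟩)) W
    have hprod : ∀ ω, ∏ k : Fin n, W (X (N + k) ω) (X (N + k + 1) ω) =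
        ∏ k ∈ Finset.range n, W (X (N + k) ω) (X (N + k + 1) ω) := fun ω =>
      Fin.prod_univ_eq_prod_range (fun k => W (X (N + k) ω) (X (N + k + 1) ω)) n
    simp only [hprod] at h
    simp only [Finset.prod_range_succ]
    rw [h, pow_succ]
    calc _ ≤ ∫⁻ ω, (∏ k ∈ Finset.range n, W (X (N + k) ω) (X (N + k + 1) ω)) * c ∂ℙ := by
          gcongr
          exact hW _
      _ = (∫⁻ ω, ∏ k ∈ Finset.range n, W (X (N + k) ω) (X (N + k + 1) ω) ∂ℙ) * c := by
          refine lintegral_mul_const _ (Finset.measurable_prod _ fun k _ => ?_)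
          exact (measurable_of_countable fun p : Fin ℓ × Fin ℓ => W p.1 p.2).comp
            ((hX.measurable _).prodMk (hX.measurable _))
      _ ≤ _ := by gcongr

/-- A Markov chain is not eventually stuck in a state which is not absorbing. -/
lemma IsMarkovChain.ae_frequently_ne [IsProbabilityMeasure ℙ] (hX : IsMarkovChain ℙ P X)
    {c : Fin ℓ} (hc : P c c < 1) : ∀ᵐ ω ∂ℙ, ∀ N, ∃ k, X (N + k) ω ≠ c := by
  rw [ae_all_iff]
  intro N
  -- The weight is the indicator of the loop at `c`, so its product over `n` steps dominates the
  -- indicator of staying there.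
  have hW : ∀ i, ∑ j, ENNReal.ofReal (P i j) * (if i = c ∧ j = c then (1 : ℝ≥0∞) else 0) ≤
      ENNReal.ofReal (P c c) := by
    intro i
    by_cases hi : i = c <;> simp [hi]
  have hle : ∀ n, ℙ {ω | ¬ ∃ k, X (N + k) ω ≠ c} ≤ ENNReal.ofReal (P c c) ^ n := by
    intro n
    refine le_trans ?_ (hX.lintegral_prod_le hW N n)
    have hm : MeasurableSet {ω | ¬ ∃ k, X (N + k) ω ≠ c} := by
      simp only [not_exists, not_not, Set.ofPred_forall]
      exact MeasurableSet.iInter fun k => hX.measurable _ (measurableSet_singleton c)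
    rw [← lintegral_indicator_one hm]
    refine lintegral_mono fun ω => ?_
    by_cases hω : ω ∈ {ω | ¬ ∃ k, X (N + k) ω ≠ c}
    · have hω' : ∀ k, X (N + k) ω = c := by simpa using hω
      simp [add_assoc, hω']
    · rw [Set.indicator_of_notMem hω]
      exact zero_le
  have hlim : Tendsto (fun n => ENNReal.ofReal (P c c) ^ n) atTop (𝓝 0) :=
    ENNReal.tendsto_pow_atTop_nhds_zero_of_lt_one (by simpa using hc)
  exact le_antisymm (ge_of_tendsto' hlim hle) zero_le

/-- One-sided law of large numbers for functions of consecutive states with zero conditional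
mean. -/
lemma IsMarkovChain.ae_eventually_sum_add_le [IsProbabilityMeasure ℙ] (hX : IsMarkovChain ℙ P X)
    (hP : P ∈ Matrix.rowStochastic ℝ (Fin ℓ)) {G : Fin ℓ → Fin ℓ → ℝ}
    (hG : ∀ i, ∑ j, P i j * G i j = 0) {δ : ℝ} (hδ : 0 < δ) :
    ∀ᵐ ω ∂ℙ, ∀ B : ℝ, ∀ᶠ n : ℕ in atTop,
      ∑ k ∈ Finset.range n, G (X k ω) (X (k + 1) ω) + B ≤ δ * n := by
  obtain ⟨M, hM1, hM⟩ : ∃ M : ℝ, 1 ≤ M ∧ ∀ i j, |G i j| ≤ M := by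
    refine ⟨1 + ∑ i, ∑ j, |G i j|, ?_, fun i j => ?_⟩
    · have : 0 ≤ ∑ i, ∑ j, |G i j| := by positivity
      linarith
    · have h1 : |G i j| ≤ ∑ j, |G i j| :=
        Finset.single_le_sum (f := fun j => |G i j|) (fun _ _ => abs_nonneg _) (Finset.mem_univ j)
      have h2 : ∑ j, |G i j| ≤ ∑ i, ∑ j, |G i j| :=
        Finset.single_le_sum (f := fun i => ∑ j, |G i j|)
          (fun _ _ => Finset.sum_nonneg fun _ _ => abs_nonneg _) (Finset.mem_univ i)
      linarith
  -- `t * M ≤ 1` allows `exp x ≤ 1 + x + x ^ 2`; the second bound makes the quadratic term cost at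
  -- most half of the discount `t * (δ / 2)` in `W`. The remaining `δ / 2` of the allowance absorbs
  -- `B`.
  obtain ⟨t, ht0, ht1, ht2⟩ : ∃ t : ℝ, 0 < t ∧ t * M ≤ 1 ∧ t * M ^ 2 ≤ δ / 4 := by
    refine ⟨min (1 / M) (δ / (4 * M ^ 2)), by positivity, ?_, ?_⟩
    · calc _ ≤ 1 / M * M := by gcongr; exact min_le_left _ _
        _ = 1 := by field_simp
    · calc _ ≤ δ / (4 * M ^ 2) * M ^ 2 := by gcongr; exact min_le_right _ _
        _ = δ / 4 := by field_simp
  set W : Fin ℓ → Fin ℓ → ℝ≥0∞ := fun i j => ENNReal.ofReal (Real.exp (t * G i j - t * (δ / 2)))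
    with hWdef
  set c : ℝ≥0∞ := ENNReal.ofReal (Real.exp (-(t * (δ / 4)))) with hc
  have hc1 : c < 1 := by
    rw [hc, ENNReal.ofReal_lt_one, Real.exp_lt_one_iff]
    have : 0 < t * (δ / 4) := by positivity
    linarith
  have hW : ∀ i, ∑ j, ENNReal.ofReal (P i j) * W i j ≤ c := by
    intro i
    simp only [hWdef, ← ENNReal.ofReal_mul (hP.1 i _)]
    rw [← ENNReal.ofReal_sum_of_nonneg fun j _ => mul_nonneg (hP.1 i j) (Real.exp_pos _).le]
    refine ENNReal.ofReal_le_ofReal ?_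
    have hexp : ∀ j, Real.exp (t * G i j) ≤ 1 + t * G i j + t ^ 2 * M ^ 2 := by
      intro j
      have habs : |t * G i j| ≤ t * M := by
        rw [abs_mul, abs_of_pos ht0]
        exact mul_le_mul_of_nonneg_left (hM i j) ht0.le
      have h1 := (abs_le.1 (Real.abs_exp_sub_one_sub_id_le (habs.trans ht1))).2
      have h2 : (t * G i j) ^ 2 ≤ (t * M) ^ 2 := sq_le_sq' (abs_le.1 habs).1 (abs_le.1 habs).2
      nlinarith
    calc ∑ j, P i j * Real.exp (t * G i j - t * (δ / 2))
        = (∑ j, P i j * Real.exp (t * G i j)) * Real.exp (-(t * (δ / 2))) := by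
          rw [Finset.sum_mul]
          refine Finset.sum_congr rfl fun j _ => ?_
          rw [mul_assoc, ← Real.exp_add, sub_eq_add_neg]
      _ ≤ (∑ j, P i j * (1 + t * G i j + t ^ 2 * M ^ 2)) * Real.exp (-(t * (δ / 2))) := by
          gcongr with j
          · exact hP.1 i j
          · exact hexp j
      _ = (t ^ 2 * M ^ 2 + 1) * Real.exp (-(t * (δ / 2))) := by
          congr 1
          have h0 : ∑ j, P i j * (t * G i j) = 0 := by
            rw [← mul_zero t, ← hG i, Finset.mul_sum]
            exact Finset.sum_congr rfl fun j _ => by ring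
          simp only [mul_add, Finset.sum_add_distrib, h0, ← Finset.sum_mul,
            Matrix.sum_row_of_mem_rowStochastic hP]
          ring
      _ ≤ Real.exp (t ^ 2 * M ^ 2) * Real.exp (-(t * (δ / 2))) := by
          gcongr
          exact Real.add_one_le_exp _
      _ ≤ Real.exp (-(t * (δ / 4))) := by
          rw [← Real.exp_add, Real.exp_le_exp]
          nlinarith [mul_le_mul_of_nonneg_left ht2 ht0.le]
  have hmeas : ∀ n : ℕ, Measurable fun ω =>
      ∏ k ∈ Finset.range n, W (X (0 + k) ω) (X (0 + k + 1) ω) := fun n =>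
    Finset.measurable_prod _ fun k _ => (measurable_of_countable
      fun p : Fin ℓ × Fin ℓ => W p.1 p.2).comp ((hX.measurable _).prodMk (hX.measurable _))
  -- The expectations are dominated by a geometric series, so almost surely the products tend to
  -- zero; once below one, their exponents are negative.
  have hfin : ∫⁻ ω, ∑' n : ℕ, ∏ k ∈ Finset.range n, W (X (0 + k) ω) (X (0 + k + 1) ω) ∂ℙ ≠ ∞ := by
    rw [lintegral_tsum fun n => (hmeas n).aemeasurable]
    refine ne_top_of_le_ne_top ?_ (ENNReal.tsum_le_tsum fun n => hX.lintegral_prod_le hW 0 n)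
    rw [ENNReal.tsum_geometric]
    exact ENNReal.inv_ne_top.2 (tsub_pos_of_lt hc1).ne'
  filter_upwards [ae_lt_top (Measurable.tsum hmeas) hfin] with ω hω B
  have hlt := (ENNReal.tendsto_atTop_zero_of_tsum_ne_top hω.ne).eventually_lt_const one_pos
  filter_upwards [hlt, (tendsto_natCast_atTop_atTop (R := ℝ)).eventually_ge_atTop (2 * B / δ)]
    with n hn hnB
  simp only [hWdef, zero_add] at hn
  rw [← ENNReal.ofReal_prod_of_nonneg fun k _ => (Real.exp_pos _).le, ← Real.exp_sum,
    ENNReal.ofReal_lt_one, Real.exp_lt_one_iff, Finset.sum_sub_distrib, ← Finset.mul_sum,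
    Finset.sum_const, Finset.card_range, nsmul_eq_mul] at hn
  rw [div_le_iff₀ hδ] at hnB
  have : ∑ k ∈ Finset.range n, G (X k ω) (X (k + 1) ω) - n * (δ / 2) < 0 := by
    by_contra! hcon
    nlinarith [mul_nonneg ht0.le hcon]
  linarith

/-- Law of large numbers for `F (X k) (X (k + 1))`, when the conditional mean of `F` is `h` plus a
coboundary. -/
lemma IsMarkovChain.ae_eventually_sum_bounds [IsProbabilityMeasure ℙ] (hX : IsMarkovChain ℙ P X)
    (hP : P ∈ Matrix.rowStochastic ℝ (Fin ℓ)) {F : Fin ℓ → Fin ℓ → ℝ} {g : Fin ℓ → ℝ} {h : ℝ}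
    (hF : ∀ i, ∑ j, P i j * F i j = h + (g i - (P *ᵥ g) i)) {δ : ℝ} (hδ : 0 < δ) :
    ∀ᵐ ω ∂ℙ, ∀ B : ℝ, ∀ᶠ n : ℕ in atTop,
      ∑ k ∈ Finset.range n, F (X k ω) (X (k + 1) ω) + B ≤ (h + δ) * n ∧
      (h - δ) * n + B ≤ ∑ k ∈ Finset.range n, F (X k ω) (X (k + 1) ω) := by
  -- The correction `g j - g i` cancels the coboundary in the mean and telescopes along the path,
  -- contributing at most `2 * M`.
  have hG : ∀ i, ∑ j, P i j * (F i j - h + (g j - g i)) = 0 := by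
    intro i
    have h1 : (P *ᵥ g) i = ∑ j, P i j * g j := rfl
    simp only [mul_add, mul_sub, Finset.sum_add_distrib, Finset.sum_sub_distrib, ← Finset.sum_mul,
      Matrix.sum_row_of_mem_rowStochastic hP, hF, h1]
    ring
  have hG' : ∀ i, ∑ j, P i j * -(F i j - h + (g j - g i)) = 0 := by
    intro i
    simp only [mul_neg, Finset.sum_neg_distrib, hG, neg_zero]
  obtain ⟨M, hM⟩ : ∃ M : ℝ, ∀ i, |g i| ≤ M :=
    ⟨∑ i, |g i|, fun i => Finset.single_le_sum (f := fun i => |g i|) (fun _ _ => abs_nonneg _)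
      (Finset.mem_univ i)⟩
  filter_upwards [hX.ae_eventually_sum_add_le hP hG hδ, hX.ae_eventually_sum_add_le hP hG' hδ]
    with ω h1 h2 B
  filter_upwards [h1 (B + 2 * M), h2 (B + 2 * M)] with n hn1 hn2
  have hsum : ∑ k ∈ Finset.range n,
      (F (X k ω) (X (k + 1) ω) - h + (g (X (k + 1) ω) - g (X k ω))) =
      ∑ k ∈ Finset.range n, F (X k ω) (X (k + 1) ω) - n * h + (g (X n ω) - g (X 0 ω)) := by
    rw [Finset.sum_add_distrib, Finset.sum_sub_distrib,
      Finset.sum_range_sub (fun k => g (X k ω))]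
    simp
  rw [Finset.sum_neg_distrib, hsum] at hn2
  rw [hsum] at hn1
  have h3 := abs_le.1 (hM (X n ω))
  have h4 := abs_le.1 (hM (X 0 ω))
  constructor <;> linarith

lemma IsMarkovChain.measure_cylinder_succ (hX : IsMarkovChain ℙ P X) (ε : ℕ → Fin ℓ) (n : ℕ) :
    ℙ {ω | ∀ i : Fin (n + 1), X i ω = ε i} =
      ℙ {ω | X 0 ω = ε 0} * ∏ k ∈ Finset.range n, ENNReal.ofReal (P (ε k) (ε (k + 1))) := by
  induction n with
  | zero => simp
  | succ n ih =>
    rw [Finset.prod_range_succ, ← mul_assoc, ← ih]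
    have := hX.transition n (fun i => ε i) (ε (n + 1))
    rw [Fin.val_last] at this
    rw [← this]
    congr 1
    ext ω
    simp [Fin.forall_fin_succ']

/-- Almost surely, the path of the chain has positive probability at all times, hence an
exponential expression. -/
lemma IsMarkovChain.ae_measure_cylinder_eq [IsProbabilityMeasure ℙ] (hX : IsMarkovChain ℙ P X) :
    ∀ᵐ ω ∂ℙ, ∃ A : ℝ, ∀ n : ℕ, ℙ {ω' | ∀ i : Fin (n + 1), X i ω' = X i ω} =
      ENNReal.ofReal (Real.exp (-(A + ∑ k ∈ Finset.range n,
        -Real.log (P (X k ω) (X (k + 1) ω))))) := by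
  have hpos : ∀ᵐ ω ∂ℙ, ∀ n : ℕ, ℙ {ω' | ∀ i : Fin (n + 1), X i ω' = X i ω} ≠ 0 := by
    rw [ae_all_iff]
    intro n
    rw [ae_iff]
    -- There are finitely many words of each length, so the null cylinders have null union.
    refine measure_mono_null (t := ⋃ z : {z : Fin (n + 1) → Fin ℓ //
      ℙ {ω' | ∀ i : Fin (n + 1), X i ω' = z i} = 0}, {ω' | ∀ i : Fin (n + 1), X i ω' = z.1 i})
      ?_ (measure_iUnion_null fun z => z.2)
    intro ω hω
    have hω' : ℙ {ω' | ∀ i : Fin (n + 1), X i ω' = X i ω} = 0 := by simpa using hω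
    exact Set.mem_iUnion.2 ⟨⟨fun i => X i ω, hω'⟩, fun i => rfl⟩
  filter_upwards [hpos] with ω hω
  have h0 : ℙ {ω' | X 0 ω' = X 0 ω} ≠ 0 := by simpa using hω 0
  have hPpos : ∀ k, 0 < P (X k ω) (X (k + 1) ω) := by
    intro k
    have := hω (k + 1)
    rw [hX.measure_cylinder_succ (fun i => X i ω), Finset.prod_range_succ, ← mul_assoc] at this
    exact ENNReal.ofReal_pos.1 (pos_iff_ne_zero.2 (right_ne_zero_of_mul this))
  refine ⟨-Real.log (ℙ {ω' | X 0 ω' = X 0 ω}).toReal, fun n => ?_⟩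
  rw [hX.measure_cylinder_succ (fun i => X i ω), Finset.sum_neg_distrib, neg_add, neg_neg, neg_neg,
    Real.exp_add, Real.exp_sum, Real.exp_log (ENNReal.toReal_pos h0 (measure_ne_top _ _)),
    ENNReal.ofReal_mul ENNReal.toReal_nonneg, ENNReal.ofReal_toReal (measure_ne_top _ _),
    ENNReal.ofReal_prod_of_nonneg fun k _ => (Real.exp_pos _).le]
  congr 1
  exact Finset.prod_congr rfl fun k _ => by rw [Real.exp_log (hPpos k)]

end Chain

end MarkovDriven

/-! ### Coding reals by digits; existence and uniqueness of the driven measure. -/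

namespace MarkovDriven

open Filter Topology

section Coding

variable {ℓ : ℕ}

lemma adicInterval_succ {n : ℕ} (ε : Fin (n + 1) → Fin ℓ) : adicInterval ε = Set.Ico
    (∑ i : Fin n, ((ε i.castSucc : ℕ) : ℝ) / (ℓ : ℝ) ^ ((i : ℕ) + 1) +
      ((ε (Fin.last n) : ℕ) : ℝ) / (ℓ : ℝ) ^ (n + 1))
    (∑ i : Fin n, ((ε i.castSucc : ℕ) : ℝ) / (ℓ : ℝ) ^ ((i : ℕ) + 1) +
      ((ε (Fin.last n) : ℕ) : ℝ) / (ℓ : ℝ) ^ (n + 1) + 1 / (ℓ : ℝ) ^ (n + 1)) := by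
  simp only [adicInterval, Fin.sum_univ_castSucc, Fin.val_castSucc, Fin.val_last]

lemma adicInterval_subset_castSucc (hℓ : 1 < ℓ) {n : ℕ} (ε : Fin (n + 1) → Fin ℓ) :
    adicInterval ε ⊆ adicInterval fun i : Fin n => ε i.castSucc := by
  have h0 : (0 : ℝ) < (ℓ : ℝ) ^ (n + 1) := by positivity
  rw [adicInterval_succ]
  refine Set.Ico_subset_Ico (le_add_of_nonneg_right (by positivity)) ?_
  rw [add_assoc]
  refine add_le_add_right ?_ _
  have h1 : ((ε (Fin.last n) : ℕ) : ℝ) + 1 ≤ ℓ := by exact_mod_cast (ε (Fin.last n)).2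
  rw [← add_div, div_le_div_iff₀ h0 (by positivity), pow_succ']
  rw [one_mul]
  gcongr

lemma eq_of_mem_adicInterval (hℓ : 1 < ℓ) {x : ℝ} : ∀ {n : ℕ} {ε ε' : Fin n → Fin ℓ},
    x ∈ adicInterval ε → x ∈ adicInterval ε' → ε = ε'
  | 0, _, _, _, _ => Subsingleton.elim _ _
  | n + 1, ε, ε', h, h' => by
    have hinit := eq_of_mem_adicInterval hℓ (adicInterval_subset_castSucc hℓ ε h)
      (adicInterval_subset_castSucc hℓ ε' h')
    have hi : ∀ i : Fin n, ε i.castSucc = ε' i.castSucc := fun i => congrFun hinit i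
    have h0 : (0 : ℝ) < (ℓ : ℝ) ^ (n + 1) := by positivity
    have hlast : ε (Fin.last n) = ε' (Fin.last n) := by
      rw [adicInterval_succ] at h h'
      simp only [← hi] at h'
      have a1 := h.1.trans_lt h'.2
      have a2 := h'.1.trans_lt h.2
      rw [add_assoc, add_lt_add_iff_left, ← add_div, div_lt_div_iff_of_pos_right h0] at a1 a2
      have b1 : (ε (Fin.last n) : ℕ) < ε' (Fin.last n) + 1 := by exact_mod_cast a1
      have b2 : (ε' (Fin.last n) : ℕ) < ε (Fin.last n) + 1 := by exact_mod_cast a2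
      exact Fin.ext (by lia)
    ext1 i
    exact Fin.lastCases hlast hi i

lemma exists_sum_eq_div (hℓ : 1 < ℓ) {n : ℕ} (ε : Fin n → Fin ℓ) : ∃ k : ℤ,
    ∑ i : Fin n, ((ε i : ℕ) : ℝ) / (ℓ : ℝ) ^ ((i : ℕ) + 1) = k / (ℓ : ℝ) ^ n := by
  induction n with
  | zero => exact ⟨0, by simp⟩
  | succ n ih =>
    obtain ⟨k, hk⟩ := ih fun i => ε i.castSucc
    refine ⟨ℓ * k + (ε (Fin.last n) : ℕ), ?_⟩
    have : (0 : ℝ) < ℓ := by positivity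
    simp only [Fin.sum_univ_castSucc, Fin.val_castSucc, Fin.val_last, hk]
    push_cast
    field_simp
    ring

lemma adicInterval_eq_adicCell (hℓ : 1 < ℓ) {n : ℕ} {ε : Fin n → Fin ℓ} {x : ℝ}
    (hx : x ∈ adicInterval ε) : adicInterval ε = adicCell ℓ n ⌊(ℓ : ℝ) ^ n * x⌋ := by
  obtain ⟨k, hk⟩ := exists_sum_eq_div hℓ ε
  have h0 : (0 : ℝ) < (ℓ : ℝ) ^ n := by positivity
  have key : ∀ y, y ∈ adicInterval ε ↔ ⌊(ℓ : ℝ) ^ n * y⌋ = k := by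
    intro y
    rw [adicInterval, hk, Set.mem_Ico, ← add_div, div_le_iff₀ h0, lt_div_iff₀ h0, Int.floor_eq_iff,
      mul_comm y]
  ext y
  rw [key y, (key x).1 hx]
  rfl

lemma sum_range_ofDigitsTerm (a : ℕ → Fin ℓ) (n : ℕ) :
    ∑ i ∈ Finset.range n, Real.ofDigitsTerm a i =
      ∑ i : Fin n, ((a i : ℕ) : ℝ) / (ℓ : ℝ) ^ ((i : ℕ) + 1) := by
  rw [Finset.sum_range]
  rfl

lemma mem_adicInterval_digits [NeZero ℓ] {x : ℝ} (hx : x ∈ Set.Ico 0 1) (n : ℕ) :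
    x ∈ adicInterval fun i : Fin n => Real.digits x ℓ i := by
  have h0 : (0 : ℝ) < (ℓ : ℝ) ^ n := by have := NeZero.pos ℓ; positivity
  have h := Real.ofDigits_digits_sum_eq (b := ℓ) hx n
  rw [sum_range_ofDigitsTerm, mul_comm, ← eq_div_iff h0.ne'] at h
  rw [adicInterval, h, Set.mem_Ico, ← add_div, div_le_iff₀ h0, lt_div_iff₀ h0, mul_comm x]
  exact ⟨Nat.floor_le (mul_nonneg h0.le hx.1), Nat.lt_floor_add_one _⟩

/-- A single digit below `ℓ - 1` leaves a gap that the tail, being at most one after rescaling,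
cannot exceed. Peeling off leading digits brings that digit to the front. -/
lemma ofDigits_lt_one (hℓ : 1 < ℓ) {a : ℕ → Fin ℓ} {k : ℕ} (hk : (a k : ℕ) + 1 ≠ ℓ) :
    Real.ofDigits a < 1 := by
  have h0 : (0 : ℝ) < ℓ := by positivity
  induction k generalizing a with
  | zero =>
    have h := Real.ofDigits_eq_sum_add_ofDigits a 1
    have h1 := Real.ofDigits_le_one fun i => a (i + 1)
    have h2 : (a 0 : ℕ) + 2 ≤ ℓ := by lia
    have h3 : ((a 0 : ℕ) : ℝ) + 2 ≤ ℓ := by exact_mod_cast h2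
    simp only [Finset.sum_range_one, Real.ofDigitsTerm, zero_add, pow_one, ← div_eq_mul_inv] at h
    rw [h, inv_mul_eq_div, ← add_div, div_lt_one h0]
    linarith
  | succ k ih =>
    have h := Real.ofDigits_eq_sum_add_ofDigits a 1
    have h1 := ih (a := fun i => a (i + 1)) hk
    have h2 : (a 0 : ℕ) + 1 ≤ ℓ := (a 0).2
    have h3 : ((a 0 : ℕ) : ℝ) + 1 ≤ ℓ := by exact_mod_cast h2
    simp only [Finset.sum_range_one, Real.ofDigitsTerm, zero_add, pow_one, ← div_eq_mul_inv] at h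
    rw [h, inv_mul_eq_div, ← add_div, div_lt_one h0]
    linarith

/-- A real number lies in the interval of each prefix of its expansion, if the latter does not end
with the digit `ℓ - 1` repeated. -/
lemma ofDigits_mem_adicInterval (hℓ : 1 < ℓ) {a : ℕ → Fin ℓ}
    (ha : ∀ N, ∃ k, (a (N + k) : ℕ) + 1 ≠ ℓ) (n : ℕ) :
    Real.ofDigits a ∈ adicInterval fun i : Fin n => a i := by
  have h0 : (0 : ℝ) < ((ℓ : ℝ) ^ n)⁻¹ := by positivity
  obtain ⟨k, hk⟩ := ha n
  have h1 : Real.ofDigits (fun i => a (i + n)) < 1 :=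
    ofDigits_lt_one hℓ (k := k) (by rwa [add_comm k n])
  have h2 := Real.ofDigits_nonneg fun i => a (i + n)
  rw [Real.ofDigits_eq_sum_add_ofDigits a n, sum_range_ofDigitsTerm, adicInterval, Set.mem_Ico,
    one_div]
  exact ⟨le_add_of_nonneg_right (by positivity), by
    rw [add_lt_add_iff_left]; exact mul_lt_of_lt_one_right h0 h1⟩

end Coding

/-- Finite measures which agree on all `b`-adic cells are equal. -/
lemma ext_of_adicCell {b : ℕ} (hb : 1 < b) {m m' : Measure ℝ} [IsFiniteMeasure m]
    (h : ∀ n k, m (adicCell b n k) = m' (adicCell b n k)) : m = m' := by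
  have hmap : ∀ n, m.map (fun x : ℝ => ⌊(b : ℝ) ^ n * x⌋) =
      m'.map (fun x : ℝ => ⌊(b : ℝ) ^ n * x⌋) := fun n =>
    Measure.ext_of_singleton fun k => by
      rw [Measure.map_apply (measurable_floor_pow_mul b n) (measurableSet_singleton k),
        Measure.map_apply (measurable_floor_pow_mul b n) (measurableSet_singleton k)]
      exact h n k
  have hpre : ∀ n (s : Set ℤ), m ((fun x : ℝ => ⌊(b : ℝ) ^ n * x⌋) ⁻¹' s) =
      m' ((fun x : ℝ => ⌊(b : ℝ) ^ n * x⌋) ⁻¹' s) := fun n s => by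
    rw [← Measure.map_apply (measurable_floor_pow_mul b n) (MeasurableSet.of_discrete (s := s)),
      hmap n,
      Measure.map_apply (measurable_floor_pow_mul b n) (MeasurableSet.of_discrete (s := s))]
  -- A ray is the increasing union over `n` of the cells of order `n` lying strictly left of the
  -- cell of `a`.
  have hIio : ∀ a : ℝ, m (Set.Iio a) = m' (Set.Iio a) := by
    intro a
    have hU : Set.Iio a = ⋃ n : ℕ, (fun x : ℝ => ⌊(b : ℝ) ^ n * x⌋) ⁻¹' Set.Iio ⌊(b : ℝ) ^ n * a⌋ := by
      ext x
      simp only [Set.mem_Iio, Set.mem_iUnion, Set.mem_preimage]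
      constructor
      · intro hx
        obtain ⟨n, hn⟩ := pow_unbounded_of_one_lt (1 / (a - x)) (Nat.one_lt_cast (α := ℝ).2 hb)
        rw [div_lt_iff₀ (sub_pos.2 hx)] at hn
        refine ⟨n, ?_⟩
        rw [Int.floor_lt]
        have := Int.lt_floor_add_one ((b : ℝ) ^ n * a)
        linarith
      · rintro ⟨n, hn⟩
        by_contra! hx
        exact absurd hn (not_lt.2 (Int.floor_le_floor (by gcongr)))
    have hmono : Monotone fun n : ℕ =>
        (fun x : ℝ => ⌊(b : ℝ) ^ n * x⌋) ⁻¹' Set.Iio ⌊(b : ℝ) ^ n * a⌋ := by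
      refine monotone_nat_of_le_succ fun n x hx => ?_
      simp only [Set.mem_preimage, Set.mem_Iio, Int.floor_lt] at hx ⊢
      have h1 : (b : ℤ) * ⌊(b : ℝ) ^ n * a⌋ ≤ ⌊(b : ℝ) ^ (n + 1) * a⌋ := by
        rw [Int.le_floor, pow_succ', mul_assoc]
        push_cast
        gcongr
        exact Int.floor_le _
      calc (b : ℝ) ^ (n + 1) * x = b * ((b : ℝ) ^ n * x) := by ring
        _ < b * (⌊(b : ℝ) ^ n * a⌋ : ℝ) := by gcongr
        _ ≤ _ := by exact_mod_cast h1
    rw [hU, hmono.measure_iUnion, hmono.measure_iUnion]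
    exact iSup_congr fun n => hpre n _
  refine ext_of_generate_finite _ (borel_eq_generateFrom_Iio ℝ ▸ BorelSpace.measurable_eq)
    isPiSystem_Iio ?_ ?_
  · rintro _ ⟨a, rfl⟩
    exact hIio a
  · simpa using hpre 0 Set.univ

section Driven

variable {Ω : Type*} [MeasurableSpace Ω] {ℙ : Measure Ω} [IsProbabilityMeasure ℙ] {ℓ : ℕ}
  {X : ℕ → Ω → Fin ℓ}

lemma IsDrivenBy.measure_compl_Ico {m : Measure ℝ} (hm : IsDrivenBy m ℙ X) :
    m (Set.Ico 0 1)ᶜ = 0 := by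
  have := hm.isProbabilityMeasure
  have h := hm.measure_adicInterval 0 Fin.elim0
  rw [prob_compl_eq_zero_iff measurableSet_Ico]
  simpa [adicInterval] using h

/-- Cells meeting `[0, 1)` are intervals of words, whose masses are prescribed; the others are null
because the empty word already carries all the mass. -/
lemma IsDrivenBy.unique [NeZero ℓ] (hℓ : 1 < ℓ) {m m' : Measure ℝ} (hm : IsDrivenBy m ℙ X)
    (hm' : IsDrivenBy m' ℙ X) : m = m' := by
  have := hm.isProbabilityMeasure
  refine ext_of_adicCell hℓ fun n k => ?_
  by_cases hk : (adicCell ℓ n k ∩ Set.Ico 0 1).Nonempty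
  · obtain ⟨x, hx, hx1⟩ := hk
    have h := adicInterval_eq_adicCell hℓ (mem_adicInterval_digits (ℓ := ℓ) hx1 n)
    rw [show ⌊(ℓ : ℝ) ^ n * x⌋ = k from hx] at h
    rw [← h, hm.measure_adicInterval, hm'.measure_adicInterval]
  · have hsub : adicCell ℓ n k ⊆ (Set.Ico 0 1)ᶜ := fun x hx hx1 => hk ⟨x, hx, hx1⟩
    rw [measure_mono_null hsub hm.measure_compl_Ico, measure_mono_null hsub hm'.measure_compl_Ico]

lemma measurable_ofDigits_comp (hX : ∀ n, Measurable (X n)) :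
    Measurable fun ω => Real.ofDigits fun i => X i ω :=
  Real.continuous_ofDigits.measurable.comp (measurable_pi_lambda _ hX)

lemma isDrivenBy_map_ofDigits (hℓ : 1 < ℓ) (hX : ∀ n, Measurable (X n))
    (h : ∀ᵐ ω ∂ℙ, ∀ N, ∃ k, (X (N + k) ω : ℕ) + 1 ≠ ℓ) :
    IsDrivenBy (ℙ.map fun ω => Real.ofDigits fun i => X i ω) ℙ X where
  isProbabilityMeasure :=
    Measure.isProbabilityMeasure_map (measurable_ofDigits_comp hX).aemeasurable
  measure_adicInterval n ε := by
    rw [Measure.map_apply (measurable_ofDigits_comp hX)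
      (show MeasurableSet (adicInterval ε) from measurableSet_Ico)]
    refine measure_congr ?_
    filter_upwards [h] with ω hω
    have hmem := ofDigits_mem_adicInterval hℓ (a := fun i => X i ω) hω n
    refine propext ⟨fun hε i => ?_, fun hε => ?_⟩
    · exact congrFun (eq_of_mem_adicInterval hℓ hmem hε) i
    · have : (fun i : Fin n => X i ω) = ε := funext hε
      rw [this] at hmem
      exact hmem

end Driven

end MarkovDriven

/-! ### Entropy rate and dimension. -/

namespace MarkovDriven

open Filter Topology
open scoped NNReal

lemma lowerDim_le_upperDim (m : Measure ℝ) : lowerDim m ≤ upperDim m :=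
  le_iInf₂ fun E hE => le_iInf fun h1 =>
    iInf₂_le_of_le E hE (iInf_le_of_le (by rw [h1]; exact one_pos) le_rfl)

lemma inv_natCast_pow_rpow {b : ℕ} (hb : 0 < b) (n : ℕ) (s : ℝ) :
    (((b : ℝ≥0∞) ^ n)⁻¹) ^ s = ENNReal.ofReal (Real.exp (-(s * Real.log b * n))) := by
  have hb' : (0 : ℝ) < b := by exact_mod_cast hb
  rw [← ENNReal.ofReal_natCast, ← ENNReal.ofReal_pow hb'.le,
    ← ENNReal.ofReal_inv_of_pos (by positivity), ENNReal.ofReal_rpow_of_pos (by positivity),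
    Real.rpow_def_of_pos (by positivity), Real.log_inv, Real.log_pow]
  congr 2
  ring

lemma measurableSet_eventually_atTop {α : Type*} [MeasurableSpace α] {p : ℕ → α → Prop}
    (hp : ∀ n, MeasurableSet {x | p n x}) : MeasurableSet {x | ∀ᶠ n in atTop, p n x} := by
  simp only [eventually_atTop, Set.ofPred_exists, Set.ofPred_forall]
  exact MeasurableSet.iUnion fun N => MeasurableSet.iInter fun n => MeasurableSet.iInter fun _ =>
    hp n

section Main

variable {Ω : Type*} [MeasurableSpace Ω] {ℙ : Measure Ω} [IsProbabilityMeasure ℙ] {ℓ : ℕ}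
  {P : Matrix (Fin ℓ) (Fin ℓ) ℝ} {X : ℕ → Ω → Fin ℓ} {π : Fin ℓ → ℝ} {s : ℝ≥0}

/-- Almost surely, the logarithm of the probability of the path up to time `n` is asymptotic to
`-n` times the entropy rate. -/
lemma IsMarkovChain.ae_eventually_measure_cylinder (hX : IsMarkovChain ℙ P X)
    (hP : P ∈ Matrix.rowStochastic ℝ (Fin ℓ)) (hirr : P.IsIrreducible) (hℓ : 1 < ℓ)
    (hπ : IsStationary P π) :
    (s < π ⬝ᵥ (fun k => entropy (P k)) → ∀ᵐ ω ∂ℙ, ∀ᶠ n in atTop,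
      ℙ {ω' | ∀ i : Fin n, X i ω' = X i ω} ≤ (((ℓ : ℝ≥0∞) ^ n)⁻¹) ^ (s : ℝ)) ∧
    (π ⬝ᵥ (fun k => entropy (P k)) < s → ∀ᵐ ω ∂ℙ, ∀ᶠ n in atTop,
      (((ℓ : ℝ≥0∞) ^ n)⁻¹) ^ (s : ℝ) ≤ ℙ {ω' | ∀ i : Fin n, X i ω' = X i ω}) := by
  set d := π ⬝ᵥ (fun k => entropy (P k)) with hd
  have hlog : 0 < Real.log ℓ := Real.log_pos (by exact_mod_cast hℓ)
  obtain ⟨c, g, hg⟩ := exists_eq_const_add_sub_mulVec hP hirr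
    fun i => ∑ j, P i j * -Real.log (P i j)
  have hc : c = d * Real.log ℓ := by
    rw [← hπ.dotProduct_eq hg, hd, dotProduct, dotProduct, Finset.sum_mul]
    refine Finset.sum_congr rfl fun i _ => ?_
    rw [mul_assoc, entropy, neg_mul, Finset.sum_mul, ← Finset.sum_neg_distrib]
    congr 1
    refine Finset.sum_congr rfl fun j _ => ?_
    rw [Real.logb]
    field_simp
  -- The offset `A` depends on the path; `B` is quantified after it so that it can be taken to be
  -- `A` or `-A`.
  have key : ∀ δ > 0, ∀ᵐ ω ∂ℙ, ∃ A : ℝ, ∀ B : ℝ, ∀ᶠ n : ℕ in atTop,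
      ∃ S : ℝ, ℙ {ω' | ∀ i : Fin n, X i ω' = X i ω} = ENNReal.ofReal (Real.exp (-(A + S))) ∧
        S + B ≤ (c + δ) * n ∧ (c - δ) * n + B ≤ S := by
    intro δ hδ
    filter_upwards [hX.ae_eventually_sum_bounds hP hg hδ, hX.ae_measure_cylinder_eq]
      with ω h1 ⟨A, hA⟩
    refine ⟨A, fun B => ?_⟩
    -- A cylinder of `n + 1` letters has `n` transitions; the absolute values added to `B` next
    -- absorb this shift.
    rw [← map_add_atTop_eq_nat 1, eventually_map]
    filter_upwards [h1 (B + |c + δ| + |c - δ|)] with n hn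
    refine ⟨_, hA n, ?_, ?_⟩
    · push_cast
      linarith [neg_abs_le (c + δ), abs_nonneg (c - δ)]
    · push_cast
      linarith [le_abs_self (c - δ), abs_nonneg (c + δ)]
  constructor
  · intro hs
    filter_upwards [key ((d - s) * Real.log ℓ) (mul_pos (sub_pos.2 hs) hlog)] with ω ⟨A, hA⟩
    filter_upwards [hA (-A)] with n ⟨S, hS, _, h2⟩
    rw [hS, inv_natCast_pow_rpow (by lia)]
    refine ENNReal.ofReal_le_ofReal (Real.exp_le_exp.2 ?_)
    have : c - (d - s) * Real.log ℓ = s * Real.log ℓ := by rw [hc]; ring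
    rw [this] at h2
    linarith
  · intro hs
    filter_upwards [key ((s - d) * Real.log ℓ) (mul_pos (sub_pos.2 hs) hlog)] with ω ⟨A, hA⟩
    filter_upwards [hA A] with n ⟨S, hS, h1, _⟩
    rw [hS, inv_natCast_pow_rpow (by lia)]
    refine ENNReal.ofReal_le_ofReal (Real.exp_le_exp.2 ?_)
    have : c + (s - d) * Real.log ℓ = s * Real.log ℓ := by rw [hc]; ring
    rw [this] at h1
    linarith

/-- The measure driven by the chain has dimension equal to the entropy rate. -/
theorem IsMarkovChain.hasDimension_map (hX : IsMarkovChain ℙ P X)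
    (hP : P ∈ Matrix.rowStochastic ℝ (Fin ℓ)) (hirr : P.IsIrreducible) (hℓ : 1 < ℓ)
    (hnt : ∀ᵐ ω ∂ℙ, ∀ N, ∃ k, (X (N + k) ω : ℕ) + 1 ≠ ℓ) (hπ : IsStationary P π) :
    HasDimension (ℙ.map fun ω => Real.ofDigits fun i => X i ω)
      (π ⬝ᵥ fun k => entropy (P k)) := by
  set d := π ⬝ᵥ fun k => entropy (P k) with hd
  set φ : Ω → ℝ := fun ω => Real.ofDigits fun i => X i ω with hφ
  have hφm : Measurable φ := measurable_ofDigits_comp hX.measurable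
  have hm := isDrivenBy_map_ofDigits hℓ hX.measurable hnt
  set m := ℙ.map φ
  have := hm.isProbabilityMeasure
  have hcell : ∀ᵐ ω ∂ℙ, ∀ n : ℕ, m (adicCell ℓ n ⌊(ℓ : ℝ) ^ n * φ ω⌋) =
      ℙ {ω' | ∀ i : Fin n, X i ω' = X i ω} := by
    filter_upwards [hnt] with ω hω n
    rw [← adicInterval_eq_adicCell hℓ (ofDigits_mem_adicInterval hℓ (a := fun i => X i ω) hω n),
      hm.measure_adicInterval]
  have hd0 : 0 ≤ d := Finset.sum_nonneg fun k _ => mul_nonneg (hπ.nonneg k)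
    (entropy_nonneg (fun j => hP.1 k j) fun j => Matrix.le_one_of_mem_rowStochastic hP)
  have hlower : ENNReal.ofReal d ≤ lowerDim m := by
    refine le_iInf₂ fun E _ => le_iInf fun hE => ENNReal.le_of_forall_nnreal_lt fun s hs => ?_
    rcases eq_or_ne s 0 with rfl | hs0
    · simp
    have hsd : (s : ℝ) < d := by
      rwa [← ENNReal.ofReal_coe_nnreal, ENNReal.ofReal_lt_ofReal_iff_of_nonneg s.coe_nonneg] at hs
    refine le_dimH_of_measure_adicCell_le m hℓ (pos_iff_ne_zero.2 hs0) ?_ hE.ne'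
    refine (ae_map_iff hφm.aemeasurable (measurableSet_eventually_atTop fun n =>
      measurableSet_le (measurable_measure_adicCell_floor m ℓ n) measurable_const)).2 ?_
    filter_upwards [hcell, (hX.ae_eventually_measure_cylinder hP hirr hℓ hπ).1 hsd] with ω h1 h2
    simpa only [h1] using h2
  have hupper : upperDim m ≤ ENNReal.ofReal d := by
    refine ENNReal.le_of_forall_nnreal_lt fun s hs => le_of_not_gt fun hlt => ?_
    -- The room between `d` and `r` gives the strict inequality needed by the almost sure lower
    -- bound on cylinder masses.
    obtain ⟨r, hr1, hr2⟩ := ENNReal.lt_iff_exists_nnreal_btwn.1 hlt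
    have hrd : d < r := by
      rwa [← ENNReal.ofReal_coe_nnreal, ENNReal.ofReal_lt_ofReal_iff_of_nonneg hd0] at hr1
    obtain ⟨E, hE, hE0, hEr⟩ := exists_dimH_le_of_le_measure_adicCell m hℓ r (by
      refine (ae_map_iff hφm.aemeasurable (measurableSet_eventually_atTop fun n =>
        measurableSet_le measurable_const (measurable_measure_adicCell_floor m ℓ n))).2 ?_
      filter_upwards [hcell, (hX.ae_eventually_measure_cylinder hP hirr hℓ hπ).2 hrd] with ω h1 h2
      simpa only [h1] using h2)
    have : upperDim m ≤ r :=
      (iInf₂_le_of_le E hE (iInf_le _ ((prob_compl_eq_zero_iff hE).1 hE0))).trans hEr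
    exact absurd (hs.trans_le this) (not_lt.2 hr2.le)
  exact ⟨hd0, le_antisymm ((lowerDim_le_upperDim m).trans hupper) hlower,
    le_antisymm hupper (hlower.trans (lowerDim_le_upperDim m))⟩

end Main

end MarkovDriven

theorem mainTheorem5 {Ω : Type*} [MeasurableSpace Ω] (ℙ : Measure Ω) [IsProbabilityMeasure ℙ]
    {ℓ : ℕ} (P : Matrix (Fin ℓ) (Fin ℓ) ℝ) (hP : P ∈ Matrix.rowStochastic ℝ (Fin ℓ))
    (hirr : P.IsIrreducible) (hne : ∀ i j, P i j ≠ 1)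
    (X : ℕ → Ω → Fin ℓ) (hX : MarkovDriven.IsMarkovChain ℙ P X) :
    (∃! m : Measure ℝ, MarkovDriven.IsDrivenBy m ℙ X) ∧
    (∃! π : Fin ℓ → ℝ, MarkovDriven.IsStationary P π) ∧
    ∀ (m : Measure ℝ) (π : Fin ℓ → ℝ),
      MarkovDriven.IsDrivenBy m ℙ X → MarkovDriven.IsStationary P π →
        MarkovDriven.HasDimension m (π ⬝ᵥ fun k => MarkovDriven.entropy (P k)) := by
  obtain ⟨ω₀⟩ : Nonempty Ω := nonempty_of_isProbabilityMeasure ℙ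
  -- With one state, stochasticity would force the excluded entry `1`.
  have hℓ : 1 < ℓ := by
    have h0 := (X 0 ω₀).pos
    by_contra! hle
    obtain rfl : ℓ = 1 := by lia
    have := Matrix.sum_row_of_mem_rowStochastic hP 0
    rw [Fin.sum_univ_one] at this
    exact hne 0 0 this
  have : NeZero ℓ := ⟨by lia⟩
  have hnt : ∀ᵐ ω ∂ℙ, ∀ N, ∃ k, (X (N + k) ω : ℕ) + 1 ≠ ℓ := by
    have hlt := lt_of_le_of_ne (Matrix.le_one_of_mem_rowStochastic hP)
      (hne ⟨ℓ - 1, by lia⟩ ⟨ℓ - 1, by lia⟩)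
    filter_upwards [hX.ae_frequently_ne hlt] with ω hω N
    obtain ⟨k, hk⟩ := hω N
    exact ⟨k, fun h => hk (Fin.ext (by simp only; lia))⟩
  have hdriven := MarkovDriven.isDrivenBy_map_ofDigits hℓ hX.measurable hnt
  refine ⟨⟨_, hdriven, fun m hm => hm.unique hℓ hdriven⟩,
    MarkovDriven.existsUnique_isStationary hP hirr, fun m π hm hπ => ?_⟩
  rw [hm.unique hℓ hdriven]
  exact hX.hasDimension_map hP hirr hℓ hnt hπ
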